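/- An inversion sequence of length $n$ is an integer sequence $(a_1,\dots,a_n)$ with $0\le a_i<i$ for all $i$. Let $\mathcal I_n(\neq,\neq,\geq)$ be the set of inversion sequences of length $n$ for which there are no $i<j<k$ with $a_i\ne a_j$, $a_j\ne a_k$ and $a_i\ge a_k$. For every $n\ge 0$ this is the set of inversion sequences of length $n$ that avoid the patterns $010,101,120,201,210$ (a sequence avoids a pattern if none of its subsequences has entries in the same relative order, equalities included, as the pattern). Let $$F(z)=\sum_{n\ge0}|\mathcal I_n(\neq,\neq,\geq)|\,z^n .$$ Consider the kernel, a quartic in $x$, $$K(x)=x^4z^2-x^3z^2-2x^3z-x^2z^2+3x^2z+x^2-xz-2x+1 .$$ It has exactly two roots in $\mathbb R[[z]]$, which are distinct and have all coefficients in $\mathbb Q(\sqrt5)$, namely $$X_1=\frac{-\sqrt{-2(\sqrt5-3)z^2-4(\sqrt5+3)z+4}-\sqrt5\,z+z+2}{4z}=1+\tfrac12(1+\sqrt5)z+(2+\sqrt5)z^2+(7+3\sqrt5)z^3+(25+11\sqrt5)z^4+(96+43\sqrt5)z^5+\cdots,$$ $$X_3=\frac{-\sqrt{2(\sqrt5+3)z^2+4(\sqrt5-3)z+4}+\sqrt5\,z+z+2}{4z}=1+\tfrac12(1-\sqrt5)z+(2-\sqrt5)z^2+(7-3\sqrt5)z^3+(25-11\sqrt5)z^4+(96-43\sqrt5)z^5+\cdots,$$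 where the square roots denote the power series with constant term $2$. Then, in $\mathbb R[[z]]$ (the denominator below being invertible), $$F(z)=-\frac{X_1z+X_3z-1}{X_1X_3z^2-X_1z-X_3z-z+1} =1+z+2z^2+5z^3+15z^4+51z^5+188z^6+733z^7+2979z^8+12495z^9+53708z^{10}+\cdots .$$ Moreover $F$ is algebraic of degree $4$ over $\mathbb Q(z)$, and up to a factor in $\mathbb Q(z)$ its minimal polynomial is $$(4z^3-2z^2+z)B^4+(2z^3-7z^2+z-1)B^3-(z^3-10z^2+3z-3)B^2-(z^2+z+3)B+2z+1 .$$ -/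

import Mathlib

open scoped RatFunc

/-- An inversion sequence `(a₁, …, aₙ)`, `0 ≤ aᵢ < i`. Positions are indexed from `0` here, so the
condition reads `a i ≤ i`. -/
def IsInversionSeq {n : ℕ} (a : Fin n → ℕ) : Prop :=
  ∀ i : Fin n, a i ≤ (i : ℕ)

/-- `a` contains the pattern `σ`: some subsequence of `a` has its entries in the same relative
order as those of `σ` (equalities included, since `<` is compared in both directions). -/
def ContainsPattern {n k : ℕ} (a : Fin n → ℕ) (σ : Fin k → ℕ) : Prop :=
  ∃ f : Fin k ↪o Fin n, ∀ i j : Fin k, a (f i) < a (f j) ↔ σ i < σ j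

/-- Inversion sequences of length `n` that avoid every pattern in `S`. -/
def patternAvoiders (n : ℕ) {k : ℕ} (S : Set (Fin k → ℕ)) : Set (Fin n → ℕ) :=
  {a | IsInversionSeq a ∧ ∀ σ ∈ S, ¬ ContainsPattern a σ}

/-- Inversion sequences of length `n` that avoid the triple of binary relations `(ρ₁, ρ₂, ρ₃)`. -/
def relationAvoiders (n : ℕ) (ρ₁ ρ₂ ρ₃ : ℕ → ℕ → Prop) : Set (Fin n → ℕ) :=
  {a | IsInversionSeq a ∧
    ¬ ∃ i j k : Fin n, i < j ∧ j < k ∧ ρ₁ (a i) (a j) ∧ ρ₂ (a j) (a k) ∧ ρ₃ (a i) (a k)}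

theorem relationAvoiders_finite (n : ℕ) (ρ₁ ρ₂ ρ₃ : ℕ → ℕ → Prop) :
    (relationAvoiders n ρ₁ ρ₂ ρ₃).Finite :=
  (Set.finite_Iic (fun i : Fin n => (i : ℕ))).subset fun _ ha i => ha.1 i

/-- The set of inversion sequences of length `n` in the class `(≠, ≠, ≥)`. -/
def classNeNeGe (n : ℕ) : Set (Fin n → ℕ) :=
  relationAvoiders n (fun x y => x ≠ y) (fun x y => x ≠ y) (fun x y => x ≥ y)

/-- The ordinary generating function of the class `(≠, ≠, ≥)`, counted by length, as a power
series over `R`. -/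
noncomputable def genFunNeNeGe (R : Type*) [Semiring R] : PowerSeries R :=
  PowerSeries.mk fun n => ((classNeNeGe n).ncard : R)

/-- The quartic kernel
`x⁴z² - x³z² - 2x³z - x²z² + 3x²z + x² - xz - 2x + 1`, as a polynomial in `x` over `ℝ⟦z⟧`. -/
noncomputable def kernelPoly : Polynomial (PowerSeries ℝ) :=
  let x : Polynomial (PowerSeries ℝ) := Polynomial.X
  let z : Polynomial (PowerSeries ℝ) := Polynomial.C PowerSeries.X
  x ^ 4 * z ^ 2 - x ^ 3 * z ^ 2 - 2 * x ^ 3 * z - x ^ 2 * z ^ 2 + 3 * x ^ 2 * z + x ^ 2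
    - x * z - 2 * x + 1

/-- `(4z³ - 2z² + z)B⁴ + (2z³ - 7z² + z - 1)B³ - (z³ - 10z² + 3z - 3)B² - (z² + z + 3)B + 2z + 1`,
as a polynomial in `B` over `ℚ[z]`. -/
noncomputable def algEqNeNeGe : Polynomial (Polynomial ℚ) :=
  let B : Polynomial (Polynomial ℚ) := Polynomial.X
  let z : Polynomial (Polynomial ℚ) := Polynomial.C Polynomial.X
  (4 * z ^ 3 - 2 * z ^ 2 + z) * B ^ 4 + (2 * z ^ 3 - 7 * z ^ 2 + z - 1) * B ^ 3
    - (z ^ 3 - 10 * z ^ 2 + 3 * z - 3) * B ^ 2 - (z ^ 2 + z + 3) * B + (2 * z + 1)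

/-- The generating function over `ℚ`, viewed in the field of Laurent series `ℚ((z)) ⊇ ℚ(z)`. -/
noncomputable def genLaurentNeNeGe : LaurentSeries ℚ :=
  HahnSeries.ofPowerSeries ℤ ℚ (genFunNeNeGe ℚ)

/-! ### The class as a pattern-avoidance class -/

/-! Let a sequence grow on the right. What may follow depends only on its length `n`, its last
letter `w` and the bound `M` just above all entries different from `w`: the next letter is `w` again
or any letter of `[M, n]` (`snoc_mem_classNeNeGe_iff`). The number of ways to append `l` letters is
affine in the number of admissible letters below `w`, with coefficients depending only on `l` and on
the number `t + 1` of letters above all entries (`completions_eq`).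

The generating functions `B t`, `D t` of these coefficients satisfy a linear system with a unique
power series solution. Inserting geometric sequences `x ^ t` leads to the kernel, which splits over
`ℚ(√5)` into the two quadratics `x = 1 + z (x² + v x)` with `v² = 1 - v`; each has one power series
root. A combination of the two geometric solutions, with weights `β`, `γ` fixed by two boundary
conditions, solves the full system (`genFunNeNeGe_eq_add`) and yields the closed form
(`genFunNeNeGe_mul`).

Clearing denominators gives the quartic for `F`. It is irreducible because it is primitive and its
specialization at `z = 1`, reduced mod 2, is the fifth cyclotomic polynomial. -/

theorem containsPattern_fin_three_iff {n : ℕ} (a : Fin n → ℕ) (x y z : ℕ) :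
    ContainsPattern a ![x, y, z] ↔ ∃ i j k : Fin n, i < j ∧ j < k ∧
      (a i < a j ↔ x < y) ∧ (a j < a i ↔ y < x) ∧ (a i < a k ↔ x < z) ∧ (a k < a i ↔ z < x) ∧
      (a j < a k ↔ y < z) ∧ (a k < a j ↔ z < y) := by
  constructor
  · rintro ⟨f, hf⟩
    refine ⟨f 0, f 1, f 2, f.strictMono (by decide), f.strictMono (by decide), ?_⟩
    exact ⟨hf 0 1, hf 1 0, hf 0 2, hf 2 0, hf 1 2, hf 2 1⟩
  · rintro ⟨i, j, k, hij, hjk, h1, h2, h3, h4, h5, h6⟩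
    refine ⟨OrderEmbedding.ofStrictMono ![i, j, k] ?_, ?_⟩
    · rw [Fin.strictMono_iff_lt_succ]
      intro s
      fin_cases s
      · exact hij
      · exact hjk
    · intro s t
      fin_cases s <;> fin_cases t <;> simp [h1, h2, h3, h4, h5, h6]

/-- The five patterns are exactly the order types of triples satisfying the three relations. -/
theorem classNeNeGe_eq_patternAvoiders (n : ℕ) : classNeNeGe n =
    patternAvoiders n ({![0, 1, 0], ![1, 0, 1], ![1, 2, 0], ![2, 0, 1], ![2, 1, 0]} :
      Set (Fin 3 → ℕ)) := by
  ext a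
  refine and_congr_right fun _ => ?_
  simp only [Set.mem_insert_iff, Set.mem_singleton_iff, forall_eq_or_imp, forall_eq,
    containsPattern_fin_three_iff]
  constructor
  · intro h
    refine ⟨?_, ?_, ?_, ?_, ?_⟩ <;>
    · rintro ⟨i, j, k, hij, hjk, hs⟩
      exact h ⟨i, j, k, hij, hjk, by omega, by omega, by omega⟩
  · rintro ⟨h1, h2, h3, h4, h5⟩ ⟨i, j, k, hij, hjk, hs⟩
    rcases lt_trichotomy (a i) (a j) with h | h | h
    · rcases hs.2.2.eq_or_lt with h' | h'
      · exact h1 ⟨i, j, k, hij, hjk, by omega⟩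
      · exact h3 ⟨i, j, k, hij, hjk, by omega⟩
    · omega
    · rcases hs.2.2.eq_or_lt with h' | h'
      · exact h2 ⟨i, j, k, hij, hjk, by omega⟩
      · rcases lt_trichotomy (a j) (a k) with h'' | h'' | h''
        · exact h4 ⟨i, j, k, hij, hjk, by omega⟩
        · omega
        · exact h5 ⟨i, j, k, hij, hjk, by omega⟩

/-! ### Growing a sequence by one letter on the right -/

/-- One more than the largest entry different from the last one; `0` if there is none. -/
def exclBound {n : ℕ} (a : Fin (n + 1) → ℕ) : ℕ :=
  Finset.univ.sup fun i => if a i = a (Fin.last n) then 0 else a i + 1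

theorem exclBound_le_iff {n : ℕ} (a : Fin (n + 1) → ℕ) (x : ℕ) :
    exclBound a ≤ x ↔ ∀ i, a i ≠ a (Fin.last n) → a i < x := by
  simp only [exclBound, Finset.sup_le_iff, Finset.mem_univ, true_imp_iff]
  refine forall_congr' fun i => ?_
  split_ifs with h <;> simp [h]

theorem mem_classNeNeGe_iff {n : ℕ} (a : Fin n → ℕ) : a ∈ classNeNeGe n ↔
    (∀ i, a i ≤ (i : ℕ)) ∧ ∀ i j k, i < j → j < k → a i ≠ a j → a j ≠ a k → a i < a k := by
  refine and_congr_right fun _ => ?_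
  push Not
  refine forall_congr' fun i => forall_congr' fun j => forall_congr' fun k => ?_
  refine forall_congr' fun _ => forall_congr' fun _ => forall_congr' fun _ => forall_congr' fun _ => ?_
  exact Iff.rfl

theorem snoc_mem_classNeNeGe_iff {n : ℕ} (a : Fin (n + 1) → ℕ) (x : ℕ) :
    (Fin.snoc a x : Fin (n + 2) → ℕ) ∈ classNeNeGe (n + 2) ↔
      a ∈ classNeNeGe (n + 1) ∧ x ≤ n + 1 ∧ (x = a (Fin.last n) ∨ exclBound a ≤ x) := by
  have key : (Fin.snoc a x : Fin (n + 2) → ℕ) ∈ classNeNeGe (n + 2) ↔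
      a ∈ classNeNeGe (n + 1) ∧ x ≤ n + 1 ∧ ∀ i j, i < j → a i ≠ a j → a j ≠ x → a i < x := by
    simp only [mem_classNeNeGe_iff, Fin.forall_fin_succ' (n := n + 1), Fin.snoc_castSucc,
      Fin.snoc_last, Fin.castSucc_lt_castSucc_iff, Fin.castSucc_lt_last, Fin.val_castSucc,
      Fin.val_last, not_lt_of_ge (Fin.le_last _), true_imp_iff, false_imp_iff, imp_true_iff,
      and_true]
    grind
  rw [key]
  refine and_congr_right fun ha => and_congr_right fun _ => ?_
  rw [mem_classNeNeGe_iff] at ha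
  rw [exclBound_le_iff]
  constructor
  · intro h
    by_cases hx : x = a (Fin.last n)
    · exact Or.inl hx
    · refine Or.inr fun i hi => h i (Fin.last n) ?_ hi (Ne.symm hx)
      exact Fin.lt_last_iff_ne_last.2 fun h => hi (by rw [h])
  · intro h i j hij h1 h2
    have hj : a j ≠ a (Fin.last n) → a i < a (Fin.last n) := fun h3 =>
      ha.2 i j _ hij (Fin.lt_last_iff_ne_last.2 fun h => h3 (by rw [h])) h1 h3
    rcases h with rfl | h
    · exact hj h2
    -- If `a i` equalled the last letter, then `a j` would differ from it, and the triple `i`, `j`,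
    -- last would already be forbidden.
    · refine h i fun h4 => ?_
      exact (hj fun h5 => h1 (h4.trans h5.symm)).ne h4

theorem exclBound_snoc_last {n : ℕ} (a : Fin (n + 1) → ℕ) :
    exclBound (Fin.snoc a (a (Fin.last n)) : Fin (n + 2) → ℕ) = exclBound a := by
  refine eq_of_forall_ge_iff fun x => ?_
  simp only [exclBound_le_iff, Fin.forall_fin_succ' (n := n + 1), Fin.snoc_castSucc, Fin.snoc_last]
  simp

/-- No entry of `a` equals the new letter: those different from the old last letter are smaller than
`x`. So the new bound lies just above the maximum of all of `a`. -/
theorem exclBound_snoc_of_ne {n : ℕ} (a : Fin (n + 1) → ℕ) {x : ℕ} (hx : x ≠ a (Fin.last n))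
    (h : exclBound a ≤ x) :
    exclBound (Fin.snoc a x : Fin (n + 2) → ℕ) = max (exclBound a) (a (Fin.last n) + 1) := by
  refine eq_of_forall_ge_iff fun y => ?_
  rw [max_le_iff, Nat.succ_le_iff]
  rw [exclBound_le_iff] at *
  rw [exclBound_le_iff]
  simp only [Fin.forall_fin_succ' (n := n + 1), Fin.snoc_castSucc, Fin.snoc_last]
  constructor
  · exact fun H => ⟨fun i hi => H.1 i (h i hi).ne, H.1 _ hx.symm⟩
  · refine fun H => ⟨fun i hi => ?_, fun h => (h rfl).elim⟩
    by_cases hi' : a i = a (Fin.last n)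
    · exact hi' ▸ H.2
    · exact H.1 i hi'

/-- The number of ways to append `l` letters to a sequence of length `n` in the class `(≠, ≠, ≥)`
whose last letter is `w` and whose other values have supremum `M - 1`. -/
def completions : ℕ → ℕ → ℕ → ℕ → ℕ
  | 0, _, _, _ => 1
  | l + 1, n, w, M => completions l (n + 1) w M +
      ∑ x ∈ (Finset.Icc M n).erase w, completions l (n + 1) x (max M (w + 1))

/-- The class `(≠, ≠, ≥)` as a finite set. -/
noncomputable def classFinset (n : ℕ) : Finset (Fin n → ℕ) :=
  (relationAvoiders_finite n (fun x y => x ≠ y) (fun x y => x ≠ y) (fun x y => x ≥ y)).toFinset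

theorem mem_classFinset {n : ℕ} {a : Fin n → ℕ} : a ∈ classFinset n ↔ a ∈ classNeNeGe n :=
  Set.Finite.mem_toFinset _

theorem ncard_classNeNeGe (n : ℕ) : (classNeNeGe n).ncard = (classFinset n).card :=
  Set.ncard_eq_toFinset_card _ _

/-- Moves one letter from the completion into the prefix. The repeated letter is listed separately
because it may lie below `exclBound a`. -/
theorem sum_completions_succ (l n : ℕ) :
    ∑ a ∈ classFinset (n + 1), completions (l + 1) (n + 1) (a (Fin.last n)) (exclBound a) =
      ∑ a ∈ classFinset (n + 2), completions l (n + 2) (a (Fin.last (n + 1))) (exclBound a) := by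
  have step : ∀ a ∈ classFinset (n + 1),
      completions (l + 1) (n + 1) (a (Fin.last n)) (exclBound a) =
      ∑ x ∈ insert (a (Fin.last n)) ((Finset.Icc (exclBound a) (n + 1)).erase (a (Fin.last n))),
        completions l (n + 2) x (exclBound (Fin.snoc a x : Fin (n + 2) → ℕ)) := by
    intro a _
    rw [Finset.sum_insert (Finset.notMem_erase _ _), exclBound_snoc_last, completions]
    congr 1
    refine Finset.sum_congr rfl fun x hx => ?_
    rw [Finset.mem_erase, Finset.mem_Icc] at hx
    rw [exclBound_snoc_of_ne a hx.1 hx.2.1]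
  rw [Finset.sum_congr rfl step, Finset.sum_sigma']
  refine Finset.sum_bij' (fun p _ => (Fin.snoc p.1 p.2 : Fin (n + 2) → ℕ))
    (fun b _ => ⟨Fin.init b, b (Fin.last (n + 1))⟩) ?_ ?_ ?_ ?_ ?_
  · rintro ⟨a, x⟩ h
    simp only [Finset.mem_sigma, Finset.mem_insert, Finset.mem_erase, Finset.mem_Icc,
      mem_classFinset] at h ⊢
    have := ((mem_classNeNeGe_iff a).1 h.1).1 (Fin.last n)
    rw [Fin.val_last] at this
    rw [snoc_mem_classNeNeGe_iff]
    refine ⟨h.1, ?_, ?_⟩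
    · rcases h.2 with h | h <;> omega
    · exact h.2.imp id fun h => h.2.1
  · intro b hb
    rw [mem_classFinset, ← Fin.snoc_init_self b, snoc_mem_classNeNeGe_iff] at hb
    simp only [Finset.mem_sigma, Finset.mem_insert, Finset.mem_erase, Finset.mem_Icc,
      mem_classFinset]
    exact ⟨hb.1, by have := hb.2; tauto⟩
  · rintro ⟨a, x⟩ _
    simp
  · intro b _
    simp
  · rintro ⟨a, x⟩ _
    simp

theorem sum_completions (l n : ℕ) :
    ∑ a ∈ classFinset (n + 1), completions l (n + 1) (a (Fin.last n)) (exclBound a) =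
      (classFinset (n + 1 + l)).card := by
  induction l generalizing n with
  | zero => simp [completions]
  | succ l ih =>
    rw [sum_completions_succ, ih, show n + 1 + 1 + l = n + 1 + (l + 1) by ring]

theorem classFinset_one : classFinset 1 = {fun _ => 0} := by
  ext a
  rw [mem_classFinset, mem_classNeNeGe_iff, Finset.mem_singleton]
  constructor
  · intro h
    ext i
    have := h.1 i
    omega
  · rintro rfl
    simp

theorem ncard_classNeNeGe_succ (l : ℕ) :
    (classNeNeGe (l + 1)).ncard = completions l 1 0 0 := by
  rw [ncard_classNeNeGe, add_comm l 1]
  have := sum_completions l 0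
  rw [← zero_add 1, ← this, classFinset_one, Finset.sum_singleton]
  rfl

theorem ncard_classNeNeGe_zero : (classNeNeGe 0).ncard = 1 := by
  rw [Set.ncard_eq_one]
  refine ⟨Fin.elim0, ?_⟩
  ext a
  rw [mem_classNeNeGe_iff]
  simp [Subsingleton.elim a Fin.elim0]

/-! ### A linear recurrence for the number of completions -/

/-- If `t + 1` values up to the length exceed all entries, the number of completions by `l` letters
is `(completionCoeffs l t).1 + e * (completionCoeffs l t).2`, where `e` is the number of values
below the last letter that may still be appended. -/
def completionCoeffs : ℕ → ℕ → ℕ × ℕ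
  | 0, _ => (1, 0)
  | l + 1, t => ((completionCoeffs l (t + 1)).1 + ∑ j ∈ Finset.range (t + 1),
        ((completionCoeffs l (t - j)).1 + j * (completionCoeffs l (t - j)).2),
      (completionCoeffs l (t + 1)).1 + (completionCoeffs l (t + 1)).2)

/-- Two kinds of states: the last letter `M + e` is the maximum, with `e` admissible letters below
it, or it lies below the maximum `m` and only a repetition or a new maximum may follow. In the
second kind the count does not depend on `w`, and it is the first count with `e = 0`. -/
theorem completions_eq (l : ℕ) :
    (∀ t M e, completions l (M + e + t + 1) (M + e) M =
      (completionCoeffs l t).1 + e * (completionCoeffs l t).2) ∧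
    (∀ t m w, w ≤ m → completions l (m + t + 1) w (m + 1) = (completionCoeffs l t).1) := by
  induction l with
  | zero => simp [completions, completionCoeffs]
  | succ l ih =>
    obtain ⟨ihA, ihB⟩ := ih
    have sum_up : ∀ t m, ∑ x ∈ Finset.Icc (m + 1) (m + t + 1),
        completions l (m + t + 1 + 1) x (m + 1) = ∑ j ∈ Finset.range (t + 1),
        ((completionCoeffs l (t - j)).1 + j * (completionCoeffs l (t - j)).2) := by
      intro t m
      rw [← Finset.Ico_succ_right_eq_Icc, Finset.sum_Ico_eq_sum_range]
      have : Order.succ (m + t + 1) - (m + 1) = t + 1 := by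
        rw [Nat.succ_eq_succ]; omega
      rw [this]
      refine Finset.sum_congr rfl fun j hj => ?_
      rw [Finset.mem_range] at hj
      rw [← ihA (t - j) (m + 1) j]
      congr 1
      omega
    constructor
    · intro t M e
      rw [completions, completionCoeffs]
      -- The `e` letters below the last lead to states of the second kind, those above to states of
      -- the first kind with new bound `M + e + 1`.
      have hsplit : (Finset.Icc M (M + e + t + 1)).erase (M + e) =
          Finset.Ico M (M + e) ∪ Finset.Icc (M + e + 1) (M + e + t + 1) := by
        ext x
        simp only [Finset.mem_erase, Finset.mem_Icc, Finset.mem_union, Finset.mem_Ico]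
        omega
      rw [hsplit, Finset.sum_union, max_eq_right (by omega), sum_up t (M + e)]
      · have h1 := ihA (t + 1) M e
        rw [← add_assoc] at h1
        have h2 : ∑ x ∈ Finset.Ico M (M + e), completions l (M + e + t + 1 + 1) x (M + e + 1) =
            e * (completionCoeffs l (t + 1)).1 := by
          have h3 : ∀ x ∈ Finset.Ico M (M + e), completions l (M + e + t + 1 + 1) x (M + e + 1) =
              (completionCoeffs l (t + 1)).1 := fun x hx =>
            ihB (t + 1) (M + e) x (by rw [Finset.mem_Ico] at hx; omega)
          rw [Finset.sum_congr rfl h3]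
          simp
        rw [h1, h2]
        ring
      · rw [Finset.disjoint_left]
        intro x
        simp only [Finset.mem_Icc, Finset.mem_Ico]
        omega
    · intro t m w hw
      rw [completions, completionCoeffs, Finset.erase_eq_of_notMem, max_eq_left (by omega),
        sum_up t m]
      · exact congrArg (· + _) (ihB (t + 1) m w hw)
      · rw [Finset.mem_Icc]
        omega

theorem ncard_classNeNeGe_eq_completionCoeffs (l : ℕ) :
    (classNeNeGe (l + 1)).ncard = (completionCoeffs l 0).1 := by
  rw [ncard_classNeNeGe_succ]
  simpa using (completions_eq l).1 0 0 0

theorem ncard_classNeNeGe_initial : (List.range 11).map (fun n => (classNeNeGe n).ncard) =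
    [1, 1, 2, 5, 15, 51, 188, 733, 2979, 12495, 53708] := by
  have h : (List.range 10).map (fun l => (completionCoeffs l 0).1) =
      [1, 2, 5, 15, 51, 188, 733, 2979, 12495, 53708] := by
    decide +kernel
  rw [List.range_succ_eq_map, List.map_cons, List.map_map, ncard_classNeNeGe_zero, ← h]
  congr 1
  exact List.map_congr_left fun l _ => ncard_classNeNeGe_eq_completionCoeffs l

/-! ### The power series roots of the kernel -/

/-- The coefficients of the power series `x` with `x = 1 + z (x² + v x)`. -/
def kernelRootCoeff {R : Type*} [CommRing R] (v : R) : ℕ → R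
  | 0 => 1
  | n + 1 => ∑ i : Fin n.succ, kernelRootCoeff v i * kernelRootCoeff v (n - i) +
      v * kernelRootCoeff v n

/-- The power series `x` with `x = 1 + z (x² + v x)`. -/
def kernelRoot {R : Type*} [CommRing R] (v : R) : PowerSeries R :=
  PowerSeries.mk (kernelRootCoeff v)

section KernelRoot

variable {R : Type*} [CommRing R]

theorem coeff_kernelRoot (v : R) (n : ℕ) :
    PowerSeries.coeff n (kernelRoot v) = kernelRootCoeff v n :=
  PowerSeries.coeff_mk _ _

theorem constantCoeff_kernelRoot (v : R) : PowerSeries.constantCoeff (kernelRoot v) = 1 := by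
  rw [← PowerSeries.coeff_zero_eq_constantCoeff_apply, coeff_kernelRoot, kernelRootCoeff]

theorem kernelRoot_eq (v : R) : kernelRoot v =
    1 + PowerSeries.X * (kernelRoot v ^ 2 + PowerSeries.C v * kernelRoot v) := by
  ext n
  cases n with
  | zero => simp [constantCoeff_kernelRoot]
  | succ n =>
    rw [map_add, PowerSeries.coeff_succ_X_mul, PowerSeries.coeff_one, if_neg n.succ_ne_zero,
      zero_add, map_add, PowerSeries.coeff_C_mul, sq, PowerSeries.coeff_mul]
    simp only [coeff_kernelRoot]
    rw [kernelRootCoeff, Finset.Nat.sum_antidiagonal_eq_sum_range_succ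
      (fun i j => kernelRootCoeff v i * kernelRootCoeff v j), Finset.sum_range]

/-- The difference of two solutions is annihilated by a series with constant term 1. -/
theorem kernelRoot_unique [IsDomain R] (v : R) {Y : PowerSeries R} :
    Y = 1 + PowerSeries.X * (Y ^ 2 + PowerSeries.C v * Y) ↔ Y = kernelRoot v := by
  refine ⟨fun hY => ?_, fun h => h ▸ kernelRoot_eq v⟩
  have h : (Y - kernelRoot v) *
      (1 - PowerSeries.X * (Y + kernelRoot v + PowerSeries.C v)) = 0 := by
    linear_combination hY - kernelRoot_eq v
  rcases mul_eq_zero.1 h with h | h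
  · exact sub_eq_zero.1 h
  · simpa using congrArg PowerSeries.constantCoeff h

theorem kernelRootCoeff_mem {S : Type*} [SetLike S R] [SubringClass S R] (s : S) {v : R}
    (hv : v ∈ s) (n : ℕ) : kernelRootCoeff v n ∈ s := by
  induction n using Nat.strong_induction_on with
  | _ n ih =>
    cases n with
    | zero => rw [kernelRootCoeff]; exact one_mem s
    | succ n =>
      rw [kernelRootCoeff]
      refine add_mem (sum_mem fun i _ => mul_mem (ih _ ?_) (ih _ ?_)) (mul_mem hv (ih _ ?_)) <;>
        omega

theorem kernelRootCoeff_initial {v : R} (hv : v ^ 2 = 1 - v) :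
    (List.range 6).map (kernelRootCoeff v) =
      [1, 1 + v, 3 + 2 * v, 10 + 6 * v, 36 + 22 * v, 139 + 86 * v] := by
  have h0 : kernelRootCoeff v 0 = 1 := by rw [kernelRootCoeff]
  have h1 : kernelRootCoeff v 1 = 1 + v := by
    rw [kernelRootCoeff]
    simp [h0]
  have h2 : kernelRootCoeff v 2 = 3 + 2 * v := by
    rw [kernelRootCoeff]
    simp only [Fin.sum_univ_succ]
    simp [h0, h1]
    linear_combination hv
  have h3 : kernelRootCoeff v 3 = 10 + 6 * v := by
    rw [kernelRootCoeff]
    simp only [Fin.sum_univ_succ]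
    simp [h0, h1, h2]
    linear_combination 3 * hv
  have h4 : kernelRootCoeff v 4 = 36 + 22 * v := by
    rw [kernelRootCoeff]
    simp only [Fin.sum_univ_succ]
    simp [h0, h1, h2, h3]
    linear_combination 10 * hv
  have h5 : kernelRootCoeff v 5 = 139 + 86 * v := by
    rw [kernelRootCoeff]
    simp only [Fin.sum_univ_succ]
    simp [h0, h1, h2, h3, h4]
    linear_combination 38 * hv
  simp [List.range_succ, h0, h1, h2, h3, h4, h5]

end KernelRoot

/-! ### The generating function in terms of the kernel roots -/

/-- Evaluates the convolution of the recurrence on a single geometric solution. The terms `-1` and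
`-(t + 1) * (v ^ 2 * (x - 1))` are the boundary defects that the combination of two roots has to
repair. -/
theorem mul_sum_range_geometric {R : Type*} [CommRing R] {z v x : R} (hv : v ^ 2 = 1 - v)
    (hx : x = 1 + z * (x ^ 2 + v * x)) (t : ℕ) :
    z * ∑ j ∈ Finset.range (t + 1), ((1 + v * (x - 1)) * x ^ (t - j + 1) +
      j * (v * (x - 1) * ((1 + v * (x - 1)) * x ^ (t - j + 1)))) =
      x ^ (t + 1) - 1 - (t + 1) * (v ^ 2 * (x - 1)) := by
  have hu : z * x * (1 + v * (x - 1)) = v * (x - 1) := by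
    linear_combination -z * x * hv - v * hx
  -- Shifting `j` by one in the weighted sum leaves this unweighted sum as a remainder.
  have hS : ∀ t : ℕ, z * ∑ j ∈ Finset.range (t + 1),
      v * (x - 1) * ((1 + v * (x - 1)) * x ^ (t - j + 1)) =
      v ^ 2 * (x - 1) * (x ^ (t + 1) - 1) := by
    intro t
    induction t with
    | zero =>
      simp only [zero_add, Finset.sum_range_one, Nat.sub_self, pow_one]
      linear_combination v * (x - 1) * hu
    | succ t ih =>
      rw [Finset.sum_range_succ', mul_add]
      simp only [Nat.add_sub_add_right, Nat.sub_zero]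
      rw [ih]
      linear_combination v * (x - 1) * x ^ (t + 1) * hu
  induction t with
  | zero =>
    simp
    linear_combination hu + (x - 1) * hv
  | succ t ih =>
    rw [Finset.sum_range_succ', mul_add]
    simp only [Nat.add_sub_add_right, Nat.sub_zero, Nat.cast_add, Nat.cast_one, Nat.cast_zero]
    have := hS t
    rw [Finset.mul_sum] at this ih ⊢
    simp only [add_mul, one_mul, mul_add z, Finset.sum_add_distrib] at this ih ⊢
    linear_combination ih + this + x ^ (t + 1) * hu + (x - 1) * x ^ (t + 1) * hv

section GenFun

open PowerSeries

variable {K : Type*} [Field K]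

/-- `h1` makes the constant defects add up to `-1`, cancelling the inhomogeneous term of the
recurrence; `h2` removes the defect linear in `t`. -/
theorem genFunNeNeGe_eq_add {v : K} (hv : v ^ 2 = 1 - v) {β γ : PowerSeries K}
    (h1 : β + γ = 1)
    (h2 : β * (C v ^ 2 * (kernelRoot v - 1)) +
      γ * (C (-1 - v) ^ 2 * (kernelRoot (-1 - v) - 1)) = 0) :
    genFunNeNeGe K = β * kernelRoot v + γ * kernelRoot (-1 - v) := by
  set x := kernelRoot v with hx
  set y := kernelRoot (-1 - v) with hy
  have hxe : x = 1 + X * (x ^ 2 + C v * x) := kernelRoot_eq v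
  have hye : y = 1 + X * (y ^ 2 + C (-1 - v) * y) := kernelRoot_eq (-1 - v)
  have hv1 : (C v : PowerSeries K) ^ 2 = 1 - C v := by rw [← map_pow, hv]; simp
  have hv3 : (C (-1 - v) : PowerSeries K) ^ 2 = 1 - C (-1 - v) := by
    rw [← map_pow, show (-1 - v) ^ 2 = 1 - (-1 - v) by linear_combination hv]; simp
  have hux : X * x * (1 + C v * (x - 1)) = C v * (x - 1) := by
    linear_combination -X * x * hv1 - C v * hxe
  have huy : X * y * (1 + C (-1 - v) * (y - 1)) = C (-1 - v) * (y - 1) := by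
    linear_combination -X * y * hv3 - C (-1 - v) * hye
  have hTx := mul_sum_range_geometric hv1 hxe
  have hTy := mul_sum_range_geometric hv3 hye
  generalize (C v : PowerSeries K) = p at *
  generalize (C (-1 - v) : PowerSeries K) = q at *
  set B : ℕ → PowerSeries K := fun t => β * ((1 + p * (x - 1)) * x ^ (t + 1)) +
    γ * ((1 + q * (y - 1)) * y ^ (t + 1)) with hB
  set D : ℕ → PowerSeries K := fun t => β * (p * (x - 1) * ((1 + p * (x - 1)) * x ^ (t + 1))) +
    γ * (q * (y - 1) * ((1 + q * (y - 1)) * y ^ (t + 1))) with hD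
  have hT : ∀ t, X * ∑ j ∈ Finset.range (t + 1), (B (t - j) + j * D (t - j)) =
      β * x ^ (t + 1) + γ * y ^ (t + 1) - 1 := by
    intro t
    have : ∑ j ∈ Finset.range (t + 1), (B (t - j) + j * D (t - j)) =
        β * ∑ j ∈ Finset.range (t + 1), ((1 + p * (x - 1)) * x ^ (t - j + 1) +
          j * (p * (x - 1) * ((1 + p * (x - 1)) * x ^ (t - j + 1)))) +
        γ * ∑ j ∈ Finset.range (t + 1), ((1 + q * (y - 1)) * y ^ (t - j + 1) +
          j * (q * (y - 1) * ((1 + q * (y - 1)) * y ^ (t - j + 1)))) := by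
      rw [Finset.mul_sum, Finset.mul_sum, ← Finset.sum_add_distrib]
      refine Finset.sum_congr rfl fun j _ => ?_
      simp only [hB, hD]
      ring
    rw [this]
    linear_combination β * hTx t + γ * hTy t - h1 - (t + 1) * h2
  have hBrec : ∀ t, B t = 1 + X * (B (t + 1) +
      ∑ j ∈ Finset.range (t + 1), (B (t - j) + j * D (t - j))) := by
    intro t
    rw [mul_add, hT t]
    simp only [hB]
    linear_combination -β * x ^ (t + 1) * hux - γ * y ^ (t + 1) * huy
  have hDrec : ∀ t, D t = X * (B (t + 1) + D (t + 1)) := by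
    intro t
    simp only [hB, hD]
    linear_combination -β * (1 + p * (x - 1)) * x ^ (t + 1) * hux -
      γ * (1 + q * (y - 1)) * y ^ (t + 1) * huy
  -- The factor `X` in `hBrec` and `hDrec` makes each coefficient depend only on earlier ones, so
  -- the recurrences determine `B` and `D`.
  have key : ∀ l t, coeff l (B t) = ((completionCoeffs l t).1 : K) ∧
      coeff l (D t) = ((completionCoeffs l t).2 : K) := by
    intro l
    induction l with
    | zero =>
      intro t
      rw [hBrec, hDrec]
      simp [completionCoeffs]
    | succ l ih =>
      intro t
      have hnat : ∀ (j : ℕ) (f : PowerSeries K), coeff l ((j : PowerSeries K) * f) =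
          j * coeff l f := fun j f => by rw [← map_natCast (C (R := K)), coeff_C_mul]
      rw [hBrec, hDrec]
      simp only [map_add, coeff_succ_X_mul, map_sum, hnat, coeff_one, completionCoeffs, ih]
      simp
  have hF : β * x + γ * y = 1 + X * B 0 := by
    have h := hT 0
    simp only [zero_add, Finset.sum_range_one, Nat.sub_self, Nat.cast_zero, zero_mul, add_zero,
      pow_one] at h
    rw [h]
    ring
  rw [hF]
  ext n
  rw [genFunNeNeGe, coeff_mk]
  cases n with
  | zero => simp [ncard_classNeNeGe_zero]
  | succ n =>
    rw [map_add, coeff_succ_X_mul, (key n 0).1, ncard_classNeNeGe_eq_completionCoeffs]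
    simp [coeff_one]

/-- With `p = z x`, `q = z y` for the two roots, this is the cross-multiplied equality of `β x + γ
y` with the closed form. -/
theorem genFun_fraction_identity {R : Type*} [CommRing R] {v z p q : R} (hv : v ^ 2 = 1 - v)
    (hp : p = z + p ^ 2 + v * z * p) (hq : q = z + q ^ 2 + (-1 - v) * z * q) :
    ((1 - p) * (1 - q) - z) * (v ^ 2 * (p - z) * q - (-1 - v) ^ 2 * (q - z) * p) =
      z * (1 - p - q) * (v ^ 2 * (p - z) - (-1 - v) ^ 2 * (q - z)) := by
  grind

theorem genFunNeNeGe_mul {v : K} (hv : v ^ 2 = 1 - v) (h5 : 1 + 2 * v ≠ 0) :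
    genFunNeNeGe K * ((1 - X * kernelRoot v) * (1 - X * kernelRoot (-1 - v)) - X) =
      1 - X * kernelRoot v - X * kernelRoot (-1 - v) := by
  have hsum : genFunNeNeGe K = _ + _ := genFunNeNeGe_eq_add hv
    -- Cramer's rule for the two boundary conditions, with `x - 1` replaced by `(x - 1) / z = x² + v
    -- x`. After this division the determinant has constant term `1 + 2 * v`, hence is invertible.
    (β := -(C (-1 - v) ^ 2 * (kernelRoot (-1 - v) ^ 2 + C (-1 - v) * kernelRoot (-1 - v)) *
      (C v ^ 2 * (kernelRoot v ^ 2 + C v * kernelRoot v) -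
        C (-1 - v) ^ 2 * (kernelRoot (-1 - v) ^ 2 + C (-1 - v) * kernelRoot (-1 - v)))⁻¹))
    (γ := C v ^ 2 * (kernelRoot v ^ 2 + C v * kernelRoot v) *
      (C v ^ 2 * (kernelRoot v ^ 2 + C v * kernelRoot v) -
        C (-1 - v) ^ 2 * (kernelRoot (-1 - v) ^ 2 + C (-1 - v) * kernelRoot (-1 - v)))⁻¹) ?_ ?_
  all_goals
    have hx := kernelRoot_eq v
    have hy := kernelRoot_eq (-1 - v)
    have hcx := constantCoeff_kernelRoot v
    have hcy := constantCoeff_kernelRoot (-1 - v)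
    set x := kernelRoot v
    set y := kernelRoot (-1 - v)
    have hden : constantCoeff (C v ^ 2 * (x ^ 2 + C v * x) -
        C (-1 - v) ^ 2 * (y ^ 2 + C (-1 - v) * y)) ≠ 0 := by
      simp only [map_sub, map_mul, map_add, map_pow, hcx, hcy, constantCoeff_C, map_neg, map_one]
      convert h5 using 1
      linear_combination (2 * v + 1) * hv
    have hinv := PowerSeries.mul_inv_cancel _ hden
  · set i := (C v ^ 2 * (x ^ 2 + C v * x) - C (-1 - v) ^ 2 * (y ^ 2 + C (-1 - v) * y))⁻¹
    have hv1 : (C v : PowerSeries K) ^ 2 = 1 - C v := by rw [← map_pow, hv]; simp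
    have hne : X ^ 3 * (C v ^ 2 * (x ^ 2 + C v * x) -
        C (-1 - v) ^ 2 * (y ^ 2 + C (-1 - v) * y)) ≠ 0 :=
      mul_ne_zero (pow_ne_zero 3 X_ne_zero) fun h => hden (by rw [h, map_zero])
    have hp : X * x = X + (X * x) ^ 2 + C v * X * (X * x) := by linear_combination X * hx
    have hC : (C (-1 - v) : PowerSeries K) = -1 - C v := by simp
    have hq : X * y = X + (X * y) ^ 2 + (-1 - C v) * X * (X * y) := by
      rw [← hC]; linear_combination X * hy
    have hid := genFun_fraction_identity hv1 hp hq
    refine mul_left_cancel₀ hne ?_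
    rw [hsum]
    rw [← hC] at hid
    linear_combination X ^ 3 * (C v ^ 2 * (x ^ 2 + C v * x) * y -
      C (-1 - v) ^ 2 * (y ^ 2 + C (-1 - v) * y) * x) * ((1 - X * x) * (1 - X * y) - X) * hinv +
      hid + ((1 - X * x) * (1 - X * y) - X) * X ^ 2 * (C (-1 - v) ^ 2 * x * hy - C v ^ 2 * y * hx) +
      X ^ 2 * (1 - X * x - X * y) * (C v ^ 2 * hx - C (-1 - v) ^ 2 * hy)
  · linear_combination hinv
  · linear_combination (-(C (-1 - v) ^ 2 * (y ^ 2 + C (-1 - v) * y)) * C v ^ 2 *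
      (C v ^ 2 * (x ^ 2 + C v * x) - C (-1 - v) ^ 2 * (y ^ 2 + C (-1 - v) * y))⁻¹) * hx +
      (C v ^ 2 * (x ^ 2 + C v * x) * C (-1 - v) ^ 2 *
      (C v ^ 2 * (x ^ 2 + C v * x) - C (-1 - v) ^ 2 * (y ^ 2 + C (-1 - v) * y))⁻¹) * hy

end GenFun

/-! ### The algebraic equation of the generating function -/

/-- The quartic at `F = (1 - p - q) / ((1 - p) * (1 - q) - z)`, multiplied by the fourth power of
the denominator. -/
theorem quartic_identity {R : Type*} [CommRing R] {v z p q : R} (hv : v ^ 2 = 1 - v)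
    (hp : p = z + p ^ 2 + v * z * p) (hq : q = z + q ^ 2 + (-1 - v) * z * q) :
    (4 * z ^ 3 - 2 * z ^ 2 + z) * (1 - p - q) ^ 4 +
      (2 * z ^ 3 - 7 * z ^ 2 + z - 1) * (1 - p - q) ^ 3 * ((1 - p) * (1 - q) - z) -
      (z ^ 3 - 10 * z ^ 2 + 3 * z - 3) * (1 - p - q) ^ 2 * ((1 - p) * (1 - q) - z) ^ 2 -
      (z ^ 2 + z + 3) * (1 - p - q) * ((1 - p) * (1 - q) - z) ^ 3 +
      (2 * z + 1) * ((1 - p) * (1 - q) - z) ^ 4 = 0 := by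
  grind

theorem constantCoeff_denominator {R : Type*} [CommRing R] (x y : PowerSeries R) :
    PowerSeries.constantCoeff ((1 - PowerSeries.X * x) * (1 - PowerSeries.X * y) -
      PowerSeries.X) = 1 := by
  simp

open PowerSeries in
theorem genFunNeNeGe_quartic {K : Type*} [Field K] {v : K} (hv : v ^ 2 = 1 - v)
    (h5 : 1 + 2 * v ≠ 0) :
    (4 * X ^ 3 - 2 * X ^ 2 + X) * genFunNeNeGe K ^ 4 +
      (2 * X ^ 3 - 7 * X ^ 2 + X - 1) * genFunNeNeGe K ^ 3 -
      (X ^ 3 - 10 * X ^ 2 + 3 * X - 3) * genFunNeNeGe K ^ 2 -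
      (X ^ 2 + X + 3) * genFunNeNeGe K + (2 * X + 1) = 0 := by
  have hx := kernelRoot_eq v
  have hy := kernelRoot_eq (-1 - v)
  have hF := genFunNeNeGe_mul hv h5
  have hD := constantCoeff_denominator (kernelRoot v) (kernelRoot (-1 - v))
  set x := kernelRoot v
  set y := kernelRoot (-1 - v)
  have hv1 : (C v : PowerSeries K) ^ 2 = 1 - C v := by rw [← map_pow, hv]; simp
  have hp : X * x = X + (X * x) ^ 2 + C v * X * (X * x) := by linear_combination X * hx
  have hC : (C (-1 - v) : PowerSeries K) = -1 - C v := by simp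
  have hq : X * y = X + (X * y) ^ 2 + (-1 - C v) * X * (X * y) := by
    rw [← hC]; linear_combination X * hy
  have hid := quartic_identity hv1 hp hq
  rw [← hF] at hid
  have hne : ((1 - X * x) * (1 - X * y) - X) ^ 4 ≠ 0 :=
    pow_ne_zero 4 fun h => by simp [h] at hD
  refine mul_left_cancel₀ hne ?_
  rw [mul_zero, ← hid]
  ring

theorem map_genFunNeNeGe : PowerSeries.map (algebraMap ℚ ℝ) (genFunNeNeGe ℚ) = genFunNeNeGe ℝ := by
  ext n
  simp [genFunNeNeGe]

theorem sqrt_five_sub_one_half : ((√5 - 1) / 2 : ℝ) ^ 2 = 1 - (√5 - 1) / 2 := by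
  have h : (√5 : ℝ) ^ 2 = 5 := Real.sq_sqrt (by norm_num)
  linear_combination h / 4

theorem one_add_two_mul_ne_zero : (1 + 2 * ((√5 - 1) / 2) : ℝ) ≠ 0 := by
  have h : (0 : ℝ) < √5 := Real.sqrt_pos.2 (by norm_num)
  intro h'
  linarith

open PowerSeries in
theorem genFunNeNeGe_rat_quartic :
    (4 * X ^ 3 - 2 * X ^ 2 + X) * genFunNeNeGe ℚ ^ 4 +
      (2 * X ^ 3 - 7 * X ^ 2 + X - 1) * genFunNeNeGe ℚ ^ 3 -
      (X ^ 3 - 10 * X ^ 2 + 3 * X - 3) * genFunNeNeGe ℚ ^ 2 -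
      (X ^ 2 + X + 3) * genFunNeNeGe ℚ + (2 * X + 1) = 0 := by
  -- The parameter `v` is irrational, but it no longer occurs in the quartic, which therefore
  -- descends from `ℝ` to `ℚ`.
  apply PowerSeries.map_injective (algebraMap ℚ ℝ) (algebraMap ℚ ℝ).injective
  rw [map_zero, ← genFunNeNeGe_quartic sqrt_five_sub_one_half one_add_two_mul_ne_zero,
    ← map_genFunNeNeGe]
  simp only [map_add, map_sub, map_mul, map_pow, map_one, map_ofNat, PowerSeries.map_X]

theorem aeval_genLaurentNeNeGe :
    Polynomial.aeval genLaurentNeNeGe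
      (algEqNeNeGe.map (algebraMap (Polynomial ℚ) (RatFunc ℚ))) = 0 := by
  have hX : algebraMap (Polynomial ℚ) (LaurentSeries ℚ) Polynomial.X =
      HahnSeries.ofPowerSeries ℤ ℚ PowerSeries.X := by
    simp
  rw [Polynomial.aeval_map_algebraMap]
  have h := congrArg (HahnSeries.ofPowerSeries ℤ ℚ) genFunNeNeGe_rat_quartic
  simp only [map_add, map_sub, map_mul, map_pow, map_one, map_ofNat, map_zero, ← hX] at h
  simp only [algEqNeNeGe, map_add, map_sub, map_mul, map_pow, map_one, map_ofNat,
    Polynomial.aeval_X, Polynomial.aeval_C]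
  exact h

/-! ### Irreducibility -/

/-- A primitive polynomial is irreducible if a specialization that keeps its degree is. -/
theorem Polynomial.IsPrimitive.irreducible_of_irreducible_map_of_leadingCoeff
    {R S : Type*} [CommRing R] [IsDomain R] [CommRing S] [IsDomain S] (φ : R →+* S)
    {f : Polynomial R} (hf : f.IsPrimitive) (hlead : φ f.leadingCoeff ≠ 0)
    (h : Irreducible (f.map φ)) : Irreducible f := by
  refine ⟨fun hu => h.not_isUnit (hu.map (Polynomial.mapRingHom φ)), fun a b hab => ?_⟩
  -- The leading coefficient of a factor survives `φ`, so a factor with unit image is constant, and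
  -- a constant dividing a primitive polynomial is a unit.
  have unit_of : ∀ a b : Polynomial R, f = a * b → IsUnit (a.map φ) → IsUnit a := by
    intro a b hab ha
    have hla : φ a.leadingCoeff ≠ 0 := fun h0 => hlead (by
      rw [hab, Polynomial.leadingCoeff_mul, map_mul, h0, zero_mul])
    have hdeg : a.natDegree = 0 := by
      rw [← Polynomial.natDegree_map_of_leadingCoeff_ne_zero φ hla]
      exact Polynomial.natDegree_eq_zero_of_isUnit ha
    rw [Polynomial.eq_C_of_natDegree_eq_zero hdeg] at hab ⊢
    exact Polynomial.isUnit_C.2 (hf _ ⟨b, hab⟩)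
  have hm : f.map φ = a.map φ * b.map φ := by rw [hab, Polynomial.map_mul]
  rcases h.isUnit_or_isUnit hm with ha | hb
  · exact Or.inl (unit_of a b hab ha)
  · exact Or.inr (unit_of b a (by rw [hab, mul_comm]) hb)

/-- The order of 2 modulo 5 is 4, the degree of the polynomial. -/
theorem irreducible_cyclotomic_five_zmod_two :
    Irreducible (Polynomial.cyclotomic 5 (ZMod 2)) := by
  refine ZMod.irreducible_of_dvd_cyclotomic_of_natDegree (p := 2) (n := 5) (by decide) dvd_rfl ?_
  rw [Polynomial.natDegree_cyclotomic, Nat.totient_prime (by norm_num)]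
  exact (orderOf_eq_prime_pow (p := 2) (n := 1) (by decide) (by decide)).symm

/-- The specialization of `algEqNeNeGe` at `z = 1`. -/
theorem algEqNeNeGe_map_eval_one : algEqNeNeGe.map (Polynomial.evalRingHom 1) =
    (3 * Polynomial.X ^ 4 - 5 * Polynomial.X ^ 3 + 9 * Polynomial.X ^ 2 - 5 * Polynomial.X + 3 :
      Polynomial ℤ).map (Int.castRingHom ℚ) := by
  simp [algEqNeNeGe]
  norm_num
  ring

theorem natDegree_specialization : (3 * Polynomial.X ^ 4 - 5 * Polynomial.X ^ 3 +
    9 * Polynomial.X ^ 2 - 5 * Polynomial.X + 3 : Polynomial ℤ).natDegree = 4 := by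
  compute_degree!

theorem specialization_eq : (3 * Polynomial.X ^ 4 - 5 * Polynomial.X ^ 3 +
    9 * Polynomial.X ^ 2 - 5 * Polynomial.X + 3 : Polynomial ℤ) =
    Polynomial.C 3 * Polynomial.X ^ 4 + Polynomial.C (-5) * Polynomial.X ^ 3 +
      Polynomial.C 9 * Polynomial.X ^ 2 + Polynomial.C (-5) * Polynomial.X + Polynomial.C 3 := by
  simp only [map_neg, map_ofNat]
  ring

theorem isPrimitive_specialization : (3 * Polynomial.X ^ 4 - 5 * Polynomial.X ^ 3 +
    9 * Polynomial.X ^ 2 - 5 * Polynomial.X + 3 : Polynomial ℤ).IsPrimitive := by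
  intro r hr
  rw [specialization_eq, Polynomial.C_dvd_iff_dvd_coeff] at hr
  have h0 := hr 0
  have h1 := hr 1
  simp [Polynomial.coeff_X, Polynomial.coeff_X_pow] at h0 h1
  refine isUnit_of_dvd_one ?_
  -- `2 * 3 - 5 = 1`.
  have := dvd_sub (h0.mul_left 2) h1
  norm_num at this
  exact this

theorem irreducible_specialization : Irreducible (3 * Polynomial.X ^ 4 - 5 * Polynomial.X ^ 3 +
    9 * Polynomial.X ^ 2 - 5 * Polynomial.X + 3 : Polynomial ℤ) := by
  refine isPrimitive_specialization.irreducible_of_irreducible_map_of_leadingCoeff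
    (Int.castRingHom (ZMod 2)) ?_ ?_
  · rw [Polynomial.leadingCoeff, natDegree_specialization, specialization_eq]
    simp [Polynomial.coeff_X, Polynomial.coeff_X_pow]
    decide
  · convert irreducible_cyclotomic_five_zmod_two
    have cyc := @Polynomial.cyclotomic_prime (ZMod 2) _ 5 ⟨by norm_num⟩
    rw [cyc, specialization_eq]
    simp only [Polynomial.map_add, Polynomial.map_mul, Polynomial.map_pow, Polynomial.map_X,
      Polynomial.map_C, Finset.sum_range_succ, Finset.sum_range_zero]
    have h3 : Int.castRingHom (ZMod 2) 3 = 1 := by decide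
    have h5 : Int.castRingHom (ZMod 2) (-5) = 1 := by decide
    have h9 : Int.castRingHom (ZMod 2) 9 = 1 := by decide
    rw [h3, h5, h9, Polynomial.C_1]
    ring

theorem algEqNeNeGe_eq : algEqNeNeGe =
    Polynomial.C (4 * Polynomial.X ^ 3 - 2 * Polynomial.X ^ 2 + Polynomial.X) * Polynomial.X ^ 4 +
    Polynomial.C (2 * Polynomial.X ^ 3 - 7 * Polynomial.X ^ 2 + Polynomial.X - 1) *
      Polynomial.X ^ 3 +
    Polynomial.C (-(Polynomial.X ^ 3 - 10 * Polynomial.X ^ 2 + 3 * Polynomial.X - 3)) *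
      Polynomial.X ^ 2 +
    Polynomial.C (-(Polynomial.X ^ 2 + Polynomial.X + 3)) * Polynomial.X +
    Polynomial.C (2 * Polynomial.X + 1) := by
  simp only [algEqNeNeGe, map_neg, map_add, map_sub, map_mul, map_pow, map_ofNat, map_one]
  ring

theorem leading_polynomial_ne_zero :
    (4 * Polynomial.X ^ 3 - 2 * Polynomial.X ^ 2 + Polynomial.X : Polynomial ℚ) ≠ 0 := by
  intro h
  have := congrArg (Polynomial.eval 1) h
  norm_num at this

theorem natDegree_algEqNeNeGe : algEqNeNeGe.natDegree = 4 := by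
  have := leading_polynomial_ne_zero
  rw [algEqNeNeGe_eq]
  compute_degree!

theorem leadingCoeff_algEqNeNeGe : algEqNeNeGe.leadingCoeff =
    4 * Polynomial.X ^ 3 - 2 * Polynomial.X ^ 2 + Polynomial.X := by
  rw [Polynomial.leadingCoeff, natDegree_algEqNeNeGe, algEqNeNeGe_eq]
  simp [-map_add, -map_sub, -map_neg, -map_mul]

theorem isPrimitive_algEqNeNeGe : algEqNeNeGe.IsPrimitive := by
  intro r hr
  rw [algEqNeNeGe_eq, Polynomial.C_dvd_iff_dvd_coeff] at hr
  have h0 := hr 0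
  have h1 := hr 1
  simp [Polynomial.coeff_X, Polynomial.coeff_C, -map_add, -map_sub, -map_neg, -map_mul,
    -neg_add_rev] at h0 h1
  -- From the two lowest coefficients: `4 (z² + z + 3) - (2z + 1)² = 11`.
  have h : r ∣ Polynomial.C 11 := by
    have h2 := dvd_add (h1.mul_left 4) (h0.mul_left (-(2 * Polynomial.X + 1)))
    convert h2 using 1
    rw [map_ofNat]
    ring
  exact isUnit_of_dvd_unit h (Polynomial.isUnit_C.2 (by norm_num))

theorem irreducible_algEqNeNeGe : Irreducible algEqNeNeGe := by
  refine isPrimitive_algEqNeNeGe.irreducible_of_irreducible_map_of_leadingCoeff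
    (Polynomial.evalRingHom 1) ?_ ?_
  · rw [leadingCoeff_algEqNeNeGe]
    norm_num
  · rw [algEqNeNeGe_map_eval_one]
    exact (Polynomial.IsPrimitive.Int.irreducible_iff_irreducible_map_cast isPrimitive_specialization).1
      irreducible_specialization

theorem map_algEqNeNeGe_eq_C_mul_minpoly :
    algEqNeNeGe.map (algebraMap (Polynomial ℚ) (RatFunc ℚ)) =
      Polynomial.C (algebraMap (Polynomial ℚ) (RatFunc ℚ)
        (4 * Polynomial.X ^ 3 - 2 * Polynomial.X ^ 2 + Polynomial.X)) *
        minpoly (RatFunc ℚ) genLaurentNeNeGe := by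
  have hirr : Irreducible (algEqNeNeGe.map (algebraMap (Polynomial ℚ) (RatFunc ℚ))) :=
    isPrimitive_algEqNeNeGe.irreducible_iff_irreducible_map_fraction_map.1 irreducible_algEqNeNeGe
  rw [← minpoly.eq_of_irreducible hirr aeval_genLaurentNeNeGe,
    Polynomial.leadingCoeff_map_of_injective (IsFractionRing.injective (Polynomial ℚ) (RatFunc ℚ)),
    leadingCoeff_algEqNeNeGe, mul_left_comm, ← Polynomial.C_mul, mul_inv_cancel₀, Polynomial.C_1,
    mul_one]
  exact (map_ne_zero_iff _ (IsFractionRing.injective (Polynomial ℚ) (RatFunc ℚ))).2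
    leading_polynomial_ne_zero

theorem natDegree_minpoly_genLaurentNeNeGe :
    (minpoly (RatFunc ℚ) genLaurentNeNeGe).natDegree = 4 := by
  have h := congrArg Polynomial.natDegree map_algEqNeNeGe_eq_C_mul_minpoly
  have hinj := IsFractionRing.injective (Polynomial ℚ) (RatFunc ℚ)
  rw [Polynomial.natDegree_map_eq_of_injective hinj, natDegree_algEqNeNeGe,
    Polynomial.natDegree_C_mul ((map_ne_zero_iff _ hinj).2 leading_polynomial_ne_zero)] at h
  exact h.symm

/-! ### The kernel -/

theorem natDegree_kernelPoly : kernelPoly.natDegree = 4 := by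
  have h : (PowerSeries.X : PowerSeries ℝ) ^ 2 ≠ 0 := pow_ne_zero 2 PowerSeries.X_ne_zero
  have hk : kernelPoly = Polynomial.C (PowerSeries.X ^ 2) * Polynomial.X ^ 4 +
      Polynomial.C (-PowerSeries.X ^ 2 - 2 * PowerSeries.X) * Polynomial.X ^ 3 +
      Polynomial.C (-PowerSeries.X ^ 2 + 3 * PowerSeries.X + 1) * Polynomial.X ^ 2 +
      Polynomial.C (-PowerSeries.X - 2) * Polynomial.X + Polynomial.C 1 := by
    simp only [kernelPoly, map_neg, map_add, map_sub, map_mul, map_pow, map_ofNat, map_one]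
    ring
  rw [hk]
  compute_degree!

theorem isRoot_kernelPoly_iff {v : ℝ} (hv : v ^ 2 = 1 - v) (Y : PowerSeries ℝ) :
    kernelPoly.IsRoot Y ↔ Y = kernelRoot v ∨ Y = kernelRoot (-1 - v) := by
  have hv1 : (PowerSeries.C v : PowerSeries ℝ) ^ 2 = 1 - PowerSeries.C v := by
    rw [← map_pow, hv]; simp
  have hC : (PowerSeries.C (-1 - v) : PowerSeries ℝ) = -1 - PowerSeries.C v := by simp
  -- The two parameters `v` and `-1 - v` have sum `-1` and product `-1`.
  have hfac : kernelPoly.eval Y =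
      (Y - (1 + PowerSeries.X * (Y ^ 2 + PowerSeries.C v * Y))) *
        (Y - (1 + PowerSeries.X * (Y ^ 2 + PowerSeries.C (-1 - v) * Y))) := by
    rw [hC]
    simp only [kernelPoly, Polynomial.eval_add, Polynomial.eval_sub, Polynomial.eval_mul,
      Polynomial.eval_pow, Polynomial.eval_X, Polynomial.eval_C, Polynomial.eval_ofNat,
      Polynomial.eval_one]
    linear_combination PowerSeries.X ^ 2 * Y ^ 2 * hv1
  rw [Polynomial.IsRoot.def, hfac, mul_eq_zero, sub_eq_zero, sub_eq_zero, kernelRoot_unique,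
    kernelRoot_unique]

/-- A kernel root solves its quadratic equation by radicals. -/
theorem kernelRoot_radical {R : Type*} [CommRing R] (v : R) :
    (2 + PowerSeries.C (-2 * v) * PowerSeries.X - 4 * PowerSeries.X * kernelRoot v) ^ 2 =
      PowerSeries.C (4 * v ^ 2) * PowerSeries.X ^ 2 -
        PowerSeries.C (8 * v + 16) * PowerSeries.X + 4 := by
  simp only [map_add, map_mul, map_neg, map_pow, map_ofNat]
  linear_combination -16 * PowerSeries.X * kernelRoot_eq v

theorem genFunNeNeGe_eq_neg_mul_inv {K : Type*} [Field K] {v : K} (hv : v ^ 2 = 1 - v)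
    (h5 : 1 + 2 * v ≠ 0) :
    genFunNeNeGe K = -((kernelRoot v * PowerSeries.X + kernelRoot (-1 - v) * PowerSeries.X - 1) *
      (kernelRoot v * kernelRoot (-1 - v) * PowerSeries.X ^ 2 - kernelRoot v * PowerSeries.X
        - kernelRoot (-1 - v) * PowerSeries.X - PowerSeries.X + 1)⁻¹) := by
  have hD : kernelRoot v * kernelRoot (-1 - v) * PowerSeries.X ^ 2 - kernelRoot v * PowerSeries.X
      - kernelRoot (-1 - v) * PowerSeries.X - PowerSeries.X + 1 =
      (1 - PowerSeries.X * kernelRoot v) * (1 - PowerSeries.X * kernelRoot (-1 - v)) -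
        PowerSeries.X := by ring
  have hc := constantCoeff_denominator (kernelRoot v) (kernelRoot (-1 - v))
  rw [hD, ← neg_mul, PowerSeries.eq_mul_inv_iff_mul_eq (by rw [hc]; exact one_ne_zero),
    genFunNeNeGe_mul hv h5]
  ring

theorem mainTheorem7 :
    -- the triple of relations and the set of patterns have the same avoiders
    (∀ n : ℕ, classNeNeGe n =
      patternAvoiders n ({![0, 1, 0], ![1, 0, 1], ![1, 2, 0], ![2, 0, 1], ![2, 1, 0]} :
        Set (Fin 3 → ℕ))) ∧
    -- the two power-series roots of the quartic kernel, and the generating function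
    kernelPoly.natDegree = 4 ∧
    (∃ X₁ X₃ : PowerSeries ℝ,
      X₁ ≠ X₃ ∧
      (∀ Y : PowerSeries ℝ, kernelPoly.IsRoot Y ↔ Y = X₁ ∨ Y = X₃) ∧
      (∀ n : ℕ, PowerSeries.coeff n X₁ ∈ IntermediateField.adjoin ℚ {(√5 : ℝ)} ∧
        PowerSeries.coeff n X₃ ∈ IntermediateField.adjoin ℚ {(√5 : ℝ)}) ∧
      -- closed forms; `S₁`, `S₃` are the square roots with constant term `2`
      (∃ S₁ S₃ : PowerSeries ℝ,
        PowerSeries.constantCoeff S₁ = 2 ∧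
        PowerSeries.constantCoeff S₃ = 2 ∧
        S₁ ^ 2 = PowerSeries.C (-2 * (√5 - 3)) * PowerSeries.X ^ 2
          - PowerSeries.C (4 * (√5 + 3)) * PowerSeries.X + 4 ∧
        S₃ ^ 2 = PowerSeries.C (2 * (√5 + 3)) * PowerSeries.X ^ 2
          + PowerSeries.C (4 * (√5 - 3)) * PowerSeries.X + 4 ∧
        4 * PowerSeries.X * X₁ =
          -S₁ - PowerSeries.C √5 * PowerSeries.X + PowerSeries.X + 2 ∧
        4 * PowerSeries.X * X₃ =
          -S₃ + PowerSeries.C √5 * PowerSeries.X + PowerSeries.X + 2) ∧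
      -- initial terms
      (List.range 6).map (fun n => PowerSeries.coeff n X₁) =
        [1, 1 / 2 * (1 + √5), 2 + √5, 7 + 3 * √5, 25 + 11 * √5, 96 + 43 * √5] ∧
      (List.range 6).map (fun n => PowerSeries.coeff n X₃) =
        [1, 1 / 2 * (1 - √5), 2 - √5, 7 - 3 * √5, 25 - 11 * √5, 96 - 43 * √5] ∧
      -- the denominator is a unit, so the quotient is a genuine one
      PowerSeries.constantCoeff (X₁ * X₃ * PowerSeries.X ^ 2 - X₁ * PowerSeries.X
        - X₃ * PowerSeries.X - PowerSeries.X + 1) ≠ 0 ∧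
      genFunNeNeGe ℝ =
        -((X₁ * PowerSeries.X + X₃ * PowerSeries.X - 1) *
          (X₁ * X₃ * PowerSeries.X ^ 2 - X₁ * PowerSeries.X - X₃ * PowerSeries.X
            - PowerSeries.X + 1)⁻¹)) ∧
    (List.range 11).map (fun n => (classNeNeGe n).ncard) =
      [1, 1, 2, 5, 15, 51, 188, 733, 2979, 12495, 53708] ∧
    -- algebraic of degree 4 over `ℚ(z)`, with explicit minimal polynomial up to normalization
    IsAlgebraic (RatFunc ℚ) genLaurentNeNeGe ∧
    (minpoly (RatFunc ℚ) genLaurentNeNeGe).natDegree = 4 ∧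
    algEqNeNeGe.map (algebraMap (Polynomial ℚ) (RatFunc ℚ)) =
      Polynomial.C (algebraMap (Polynomial ℚ) (RatFunc ℚ)
        (4 * Polynomial.X ^ 3 - 2 * Polynomial.X ^ 2 + Polynomial.X)) *
        minpoly (RatFunc ℚ) genLaurentNeNeGe := by
  have h5 : (√5 : ℝ) ^ 2 = 5 := Real.sq_sqrt (by norm_num)
  have hv := sqrt_five_sub_one_half
  have hv' : (-1 - (√5 - 1) / 2 : ℝ) ^ 2 = 1 - (-1 - (√5 - 1) / 2) := by linear_combination hv
  have hne := one_add_two_mul_ne_zero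
  have hX₁ := kernelRootCoeff_initial hv
  have hX₃ := kernelRootCoeff_initial hv'
  have hmem : (√5 : ℝ) ∈ IntermediateField.adjoin ℚ {(√5 : ℝ)} :=
    IntermediateField.mem_adjoin_simple_self ℚ _
  have hvmem : ((√5 - 1) / 2 : ℝ) ∈ IntermediateField.adjoin ℚ {(√5 : ℝ)} :=
    div_mem (sub_mem hmem (one_mem _)) (ofNat_mem _ 2)
  -- The square roots are `2 - 2 v z - 4 z X`, supplied by `kernelRoot_radical`; `v = (√5 - 1) / 2`
  -- gives `X₁` and its conjugate `-1 - v` gives `X₃`.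
  refine ⟨classNeNeGe_eq_patternAvoiders, natDegree_kernelPoly,
    ⟨kernelRoot ((√5 - 1) / 2), kernelRoot (-1 - (√5 - 1) / 2), ?_, isRoot_kernelPoly_iff hv,
      fun n => ⟨?_, ?_⟩, ⟨_, _, ?_, ?_, (kernelRoot_radical ((√5 - 1) / 2)).trans ?_,
        (kernelRoot_radical (-1 - (√5 - 1) / 2)).trans ?_, ?_, ?_⟩, ?_, ?_, ?_,
      genFunNeNeGe_eq_neg_mul_inv hv hne⟩,
    ncard_classNeNeGe_initial, ?_, natDegree_minpoly_genLaurentNeNeGe,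
    map_algEqNeNeGe_eq_C_mul_minpoly⟩
  · intro h
    have h1 := congrArg (PowerSeries.coeff 1) h
    simp only [List.range_succ, List.range_zero, List.nil_append, List.cons_append, List.map_cons,
      List.map_nil, List.cons.injEq] at hX₁ hX₃
    rw [coeff_kernelRoot, coeff_kernelRoot, hX₁.2.1, hX₃.2.1] at h1
    exact hne (by linear_combination h1)
  · rw [coeff_kernelRoot]
    exact kernelRootCoeff_mem _ hvmem n
  · rw [coeff_kernelRoot]
    exact kernelRootCoeff_mem _ (sub_mem (neg_mem (one_mem _)) hvmem) n
  · simp [map_ofNat]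
  · simp [map_ofNat]
  · rw [show 4 * ((√5 - 1) / 2 : ℝ) ^ 2 = -2 * (√5 - 3) by linear_combination h5,
      show 8 * ((√5 - 1) / 2 : ℝ) + 16 = 4 * (√5 + 3) by ring]
  · rw [show 4 * (-1 - (√5 - 1) / 2 : ℝ) ^ 2 = 2 * (√5 + 3) by linear_combination h5,
      show 8 * (-1 - (√5 - 1) / 2 : ℝ) + 16 = -(4 * (√5 - 3)) by ring, map_neg]
    ring
  · rw [show -2 * ((√5 - 1) / 2 : ℝ) = 1 - √5 by ring, map_sub, map_one]
    ring
  · rw [show -2 * (-1 - (√5 - 1) / 2 : ℝ) = 1 + √5 by ring, map_add, map_one]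
    ring
  · simp only [coeff_kernelRoot, hX₁, List.cons.injEq, and_true, true_and]
    refine ⟨?_, ?_, ?_, ?_, ?_⟩ <;> ring
  · simp only [coeff_kernelRoot, hX₃, List.cons.injEq, and_true, true_and]
    refine ⟨?_, ?_, ?_, ?_, ?_⟩ <;> ring
  · simp
  · refine isAlgebraic_iff_isIntegral.2 (minpoly.ne_zero_iff.1 fun h => ?_)
    have := natDegree_minpoly_genLaurentNeNeGe
    rw [h, Polynomial.natDegree_zero] at this
    omega
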